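/- Let $\mathscr{E}$ be the ring of germs at the origin of smooth real functions of $(x,\lambda)\in\mathbb{R}^2$, and $\mathcal{M}=\langle x,\lambda\rangle_{\mathscr{E}}$ its maximal ideal. For $f\in\mathscr{E}$ let $J^\infty(f)$ be its Taylor series at the origin and $\mathrm{Terms}(f)$ the set of the nonzero terms of $J^\infty(f)$; $f$ is flat if $J^\infty(f)=0$. A local order $\prec$ is a strict total order on the monomials $X^\alpha=x^{\alpha_1}\lambda^{\alpha_2}$ such that $X^\alpha\prec X^\beta$ implies $X^{\alpha+\gamma}\prec X^{\beta+\gamma}$, and $x\prec 1$, $\lambda\prec 1$; terms are compared through their monomials, and $0\prec X^\alpha$ for all $\alpha$. For non-flat $f$, $LT(f)$ is the $\prec$-largest term of $f$ and $LC(f)$ is its coefficient; $LT(f)=0$ for flat $f$. The anti-graded lexicographic order is defined by $X^\alpha\prec_{\rm alex}X^\beta$ iff $\deg X^\alpha>\deg X^\beta$, or the degrees are equal and $\alpha_i<\beta_i$ for the first $i$ with $\alpha_i\ne\beta_i$. A finite set $G\subset\mathscr{E}$ is a standard basis of an ideal $I$ if it generates $I$ and $\langle LT(f): f\in I\rangle_{\mathscr{E}}=\langle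 LT(g): g\in G\rangle_{\mathscr{E}}$. It is a reduced standard basis if moreover $LC(g)=1$ for all $g\in G$ and, for all $g,h\in G$, $LT(g)$ divides no $t\in\mathrm{Terms}(h)$, except when $g=h$ and $t=LT(g)$. A remainder of $f\in\mathscr{E}$ with respect to $G$ and $\prec$ is a germ $s=f-\sum_{g\in G}q_g g$ with $q_g\in\mathscr{E}$ and $LT(q_g g)\preceq LT(f)$ for all $g\in G$, such that no term of $s$ is divisible by any $LT(g)$, $g\in G$. A germ is called polynomial if it is the germ of a polynomial in $x,\lambda$. Let $I$ be an ideal of $\mathscr{E}$ of finite codimension, i.e. $\mathcal{M}^k\subseteq I$ for some $k\in\mathbb{N}$. (1) For every local order, $I$ has exactly one reduced standard basis that consists of polynomial germs. Moreover, any two reduced standard bases of $I$ (for the same local order) agree modulo flat germs, i.e. have the same set of Taylor series. (2) Let $G$ be a standard basis of $I$ with respect to $\prec_{\rm alex}$ and let $f\in\mathscr{E}$. Then, among the remainders of $f$ with respect to $G$ and $\prec_{\rm alex}$, there is exactly one polynomial germ, say that of $p$; every remainder of $f$ with respect to $G$ and $\prec_{\rm alex}$ differs from it by a flat germ; and $\deg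 p\le k$ for every $k\ge 0$ with $\mathcal{M}^{k+1}\subseteq I$. -/

import Mathlib

open Filter Topology
open scoped ContDiff

/-- Points `(x, λ)` of the plane: `v 0 = x` is the state variable, `v 1 = λ` the parameter. -/
abbrev Plane : Type := Fin 2 → ℝ

/-- Exponents `α` of the monomials `X^α = x ^ α 0 * λ ^ α 1`. -/
abbrev Expo : Type := Fin 2 →₀ ℕ

/-- The ring `𝓔` of germs at the origin of real functions that are smooth near the origin. -/
def smoothGerms : Subring (Germ (𝓝 (0 : Plane)) ℝ) where
  carrier := {u | ∃ f : Plane → ℝ, (∀ᶠ v in 𝓝 (0 : Plane), ContDiffAt ℝ ∞ f v) ∧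
    (f : Germ (𝓝 (0 : Plane)) ℝ) = u}
  mul_mem' := by
    rintro _ _ ⟨f, hf, rfl⟩ ⟨g, hg, rfl⟩
    refine ⟨f * g, ?_, rfl⟩
    filter_upwards [hf, hg] with v h1 h2
    exact h1.mul h2
  add_mem' := by
    rintro _ _ ⟨f, hf, rfl⟩ ⟨g, hg, rfl⟩
    refine ⟨f + g, ?_, rfl⟩
    filter_upwards [hf, hg] with v h1 h2
    exact h1.add h2
  neg_mem' := by
    rintro _ ⟨f, hf, rfl⟩
    refine ⟨-f, ?_, rfl⟩
    filter_upwards [hf] with v h1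
    exact h1.neg
  one_mem' := ⟨fun _ => 1, Eventually.of_forall fun _ => contDiffAt_const, rfl⟩
  zero_mem' := ⟨fun _ => 0, Eventually.of_forall fun _ => contDiffAt_const, rfl⟩

abbrev SmoothGerm : Type := smoothGerms

theorem contDiff_polynomial_eval (p : MvPolynomial (Fin 2) ℝ) :
    ContDiff ℝ ∞ (fun v : Plane => MvPolynomial.eval v p) := by
  induction p using MvPolynomial.induction_on with
  | C a => simpa using contDiff_const
  | add p q hp hq => simpa using hp.add hq
  | mul_X p i hp => simpa using hp.mul (contDiff_apply ℝ ℝ i)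

/-- The germ at the origin of a polynomial function in `(x, λ)`. -/
noncomputable def polyGerm (p : MvPolynomial (Fin 2) ℝ) : SmoothGerm :=
  ⟨((fun v : Plane => MvPolynomial.eval v p : Plane → ℝ) : Germ (𝓝 (0 : Plane)) ℝ),
    ⟨_, Eventually.of_forall fun _ => (contDiff_polynomial_eval p).contDiffAt, rfl⟩⟩

/-- The germ has a polynomial representative. -/
def IsPolynomialGerm (g : SmoothGerm) : Prop := ∃ p, polyGerm p = g

/-- The maximal ideal `M = ⟨x, λ⟩` of `𝓔`. -/
noncomputable def maxIdeal : Ideal SmoothGerm :=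
  Ideal.span {polyGerm (MvPolynomial.X 0), polyGerm (MvPolynomial.X 1)}

def FiniteCodimension (I : Ideal SmoothGerm) : Prop := ∃ k : ℕ, maxIdeal ^ k ≤ I

/-! Taylor expansion at the origin. -/

/-- The partial derivative in the direction of the `i`-th coordinate. -/
noncomputable def partialD (i : Fin 2) (f : Plane → ℝ) : Plane → ℝ :=
  fun v => fderiv ℝ f v (Pi.single i 1)

theorem partialD_iterate_congr (i : Fin 2) (n : ℕ) {f g : Plane → ℝ}
    (h : f =ᶠ[𝓝 0] g) : (partialD i)^[n] f =ᶠ[𝓝 0] (partialD i)^[n] g := by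
  induction n with
  | zero => exact h
  | succ n ih =>
    rw [Function.iterate_succ_apply', Function.iterate_succ_apply']
    exact (ih.fderiv (𝕜 := ℝ)).mono fun v hv => by simp only [partialD, hv]

/-- The Taylor coefficient `(∂_x ^ i ∂_λ ^ j f) (0) / (i! j!)` for `α = (i, j)`. -/
noncomputable def taylorCoeff (u : SmoothGerm) (α : Expo) : ℝ :=
  Germ.liftOn u.1
    (fun f => (partialD 0)^[α 0] ((partialD 1)^[α 1] f) 0 / (((α 0).factorial : ℝ) * (α 1).factorial))
    (fun _ _ h => by
      simp only [(partialD_iterate_congr 0 (α 0) (partialD_iterate_congr 1 (α 1) h)).eq_of_nhds])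

/-- The infinite jet `J^∞(u)`, as a formal power series. -/
noncomputable def infJet (u : SmoothGerm) : MvPowerSeries (Fin 2) ℝ := fun α => taylorCoeff u α

def IsFlat (u : SmoothGerm) : Prop := infJet u = 0

/-- The set of terms `a_α X^α`, `a_α ≠ 0`, of the Taylor expansion of `f`. -/
def Terms (f : SmoothGerm) : Set SmoothGerm :=
  {t | ∃ α, taylorCoeff f α ≠ 0 ∧ t = polyGerm (MvPolynomial.monomial α (taylorCoeff f α))}

/-! Local orders; `r α β` stands for `X^α ≺ X^β`. -/

structure IsLocalOrder (r : Expo → Expo → Prop) : Prop where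
  strictTotal : IsStrictTotalOrder Expo r
  add_right : ∀ α β γ, r α β → r (α + γ) (β + γ)
  var_lt_one : ∀ i, r (Finsupp.single i 1) 0

/-- Lexicographic order: at the first index where they differ, `α` is smaller than `β`. -/
def lexLT (α β : Expo) : Prop := ∃ i, (∀ j, j < i → α j = β j) ∧ α i < β i

/-- Anti-graded lexicographic order. -/
def alexLT (α β : Expo) : Prop :=
  β.degree < α.degree ∨ (α.degree = β.degree ∧ lexLT α β)

/-- `X^α` is the leading monomial of `f`. -/
def IsLeadExpo (r : Expo → Expo → Prop) (f : SmoothGerm) (α : Expo) : Prop :=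
  taylorCoeff f α ≠ 0 ∧ ∀ β, taylorCoeff f β ≠ 0 → β ≠ α → r β α

open Classical in
/-- The leading term `LT(f)` (which is `0` when `f` is flat). -/
noncomputable def leadTerm (r : Expo → Expo → Prop) (f : SmoothGerm) : SmoothGerm :=
  if h : ∃ α, IsLeadExpo r f α then
    polyGerm (MvPolynomial.monomial h.choose (taylorCoeff f h.choose)) else 0

open Classical in
/-- The leading coefficient `LC(f)` (which is `0` when `f` is flat). -/
noncomputable def leadCoeff (r : Expo → Expo → Prop) (f : SmoothGerm) : ℝ :=
  if h : ∃ α, IsLeadExpo r f α then taylorCoeff f h.choose else 0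

/-- `LT(h) ≼ LT(f)`: terms are compared through their monomials, and `0 ≺ X^α` for all `α`. -/
def LeadLE (r : Expo → Expo → Prop) (h f : SmoothGerm) : Prop :=
  ∀ α, IsLeadExpo r h α → ∃ β, IsLeadExpo r f β ∧ (α = β ∨ r α β)

/-- `LT(I)`, the ideal of `𝓔` generated by the leading terms of the elements of `I`. -/
noncomputable def leadIdeal (r : Expo → Expo → Prop) (I : Ideal SmoothGerm) : Ideal SmoothGerm :=
  Ideal.span {t | ∃ f ∈ I, t = leadTerm r f}

structure IsStandardBasis (r : Expo → Expo → Prop) (I : Ideal SmoothGerm)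
    (G : Finset SmoothGerm) : Prop where
  span_eq : Ideal.span (G : Set SmoothGerm) = I
  leadIdeal_eq : leadIdeal r I = Ideal.span {t | ∃ g ∈ G, t = leadTerm r g}

structure IsReducedStandardBasis (r : Expo → Expo → Prop) (I : Ideal SmoothGerm)
    (G : Finset SmoothGerm) : Prop extends IsStandardBasis r I G where
  leadCoeff_eq_one : ∀ g ∈ G, leadCoeff r g = 1
  reduced : ∀ g ∈ G, ∀ h ∈ G, ∀ t ∈ Terms h,
    ¬ (g = h ∧ t = leadTerm r g) → ¬ leadTerm r g ∣ t

/-- `s` is a remainder of `f` with respect to the finite set `G` and the order `r`. -/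
def IsRemainder (r : Expo → Expo → Prop) (f : SmoothGerm) (G : Finset SmoothGerm)
    (s : SmoothGerm) : Prop :=
  (∃ q : SmoothGerm → SmoothGerm,
    (∀ g ∈ G, LeadLE r (q g * g) f) ∧ s = f - ∑ g ∈ G, q g * g) ∧
  ∀ t ∈ Terms s, ∀ g ∈ G, ¬ leadTerm r g ∣ t

/-!
Hadamard's lemma writes a smooth `u` with `u(0) = 0` as `x w₀ + λ w₁`, where the Taylor series of
the `wᵢ` only involve monomials `X^α` for which `X^α Xᵢ` occurs in the series of `u`. Iterating,
`𝓜 ^ n` consists of the germs without monomials of degree `< n`, and flat germs lie in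
`𝓜 ^ n` times the ideal of flat germs.

A germ can therefore be divided by `G` modulo `𝓜 ^ n`: only finitely many monomials have degree
`< n`, so reducing the largest one divisible by a leading monomial terminates. For `G ⊆ I` with the
leading monomials of `I` this gives `I ≤ ⟨G⟩ + 𝓜 ^ n` for all large `n`, and Nakayama's lemma gives
`I = ⟨G⟩`. Uniqueness rests on one fact: an element of `I` without monomials divisible by a
leading monomial of `I` is flat.

For a remainder of `f` the error in `𝓜 ^ (n + k) ≤ 𝓜 ^ n * I` is absorbed too, provided all
monomials of degree at least `n` are `≼ LT(f)`, which some `n` achieves as soon as only finitely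
many monomials exceed `LT(f)`.
-/

section SmoothFunctions

variable {E F : Type*} [NormedAddCommGroup E] [NormedSpace ℝ E]
  [NormedAddCommGroup F] [NormedSpace ℝ F]

theorem exists_contDiff_eventuallyEq [HasContDiffBump E] {n : ℕ∞} {f : E → F} {c : E}
    (hf : ∀ᶠ v in 𝓝 c, ContDiffAt ℝ n f v) : ∃ g : E → F, ContDiff ℝ n g ∧ g =ᶠ[𝓝 c] f := by
  obtain ⟨ε, hε, hfε⟩ := Metric.eventually_nhds_iff_ball.1 hf
  let χ : ContDiffBump c := ⟨ε / 3, ε / 2, by positivity, by linarith⟩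
  refine ⟨fun v => χ v • f v, contDiff_iff_contDiffAt.2 fun v => ?_, ?_⟩
  · by_cases hv : v ∈ Metric.ball c ε
    · exact χ.contDiff.contDiffAt.smul (hfε v hv)
    · have hχ : v ∉ tsupport χ := fun hmem =>
        hv (Metric.closedBall_subset_ball (half_lt_self hε) (χ.tsupport_eq ▸ hmem))
      refine contDiffAt_const (c := (0 : F)) |>.congr_of_eventuallyEq ?_
      filter_upwards [notMem_tsupport_iff_eventuallyEq.1 hχ] with w hw
      simp [hw]
  · filter_upwards [χ.eventuallyEq_one] with v hv
    simp [hv]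

/-- The mean of `g` over the segment from `0` to `v`, with weight `t ^ m` at `t • v`. It provides
the smooth cofactors in Hadamard's lemma. -/
noncomputable def radialMean (m : ℕ) (g : E → F) (v : E) : F :=
  ∫ t in (0 : ℝ)..1, t ^ m • g (t • v)

theorem continuous_radialMean {g : E → F} (hg : Continuous g) (m : ℕ) :
    Continuous (radialMean m g) :=
  intervalIntegral.continuous_parametric_intervalIntegral_of_continuous' (by fun_prop) 0 1

theorem radialMean_apply_zero [CompleteSpace F] (g : E → F) (m : ℕ) :
    radialMean m g 0 = ((m : ℝ) + 1)⁻¹ • g 0 := by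
  simp [radialMean, intervalIntegral.integral_smul_const]

theorem radialMean_clm_apply {D : E → E →L[ℝ] F} (hD : Continuous D) (m : ℕ) (v y : E) :
    radialMean m (fun w => D w y) v = radialMean m D v y :=
  (ContinuousLinearMap.intervalIntegral_apply (φ := fun t => t ^ m • D (t • v))
    (Continuous.intervalIntegrable (by fun_prop) 0 1) y).symm

theorem hasFDerivAt_radialMean [FiniteDimensional ℝ E] {g : E → F} (hg : ContDiff ℝ 1 g)
    (m : ℕ) (v : E) : HasFDerivAt (radialMean m g) (radialMean (m + 1) (fderiv ℝ g) v) v := by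
  have := FiniteDimensional.proper ℝ E
  have hgc : Continuous g := hg.continuous
  have : Continuous (fderiv ℝ g) := hg.continuous_fderiv one_ne_zero
  obtain ⟨C, hC⟩ := ((isCompact_closedBall v 1).prod (isCompact_Icc (a := (0 : ℝ)) (b := 1))
    ).exists_bound_of_continuousOn (f := fun p => p.2 ^ (m + 1) • fderiv ℝ g (p.2 • p.1))
    (by fun_prop)
  refine intervalIntegral.hasFDerivAt_integral_of_dominated_of_fderiv_le
    (F' := fun w t => t ^ (m + 1) • fderiv ℝ g (t • w)) (bound := fun _ => C)
    (Metric.closedBall_mem_nhds v one_pos)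
    (.of_forall fun w => Continuous.aestronglyMeasurable (by fun_prop))
    (Continuous.intervalIntegrable (by fun_prop) _ _)
    (Continuous.aestronglyMeasurable (by fun_prop)) ?_ intervalIntegrable_const ?_
  · refine .of_forall fun t ht w hw => hC (w, t) ⟨hw, ?_⟩
    rw [Set.uIoc_of_le zero_le_one] at ht
    exact ⟨ht.1.le, ht.2⟩
  · refine .of_forall fun t _ w _ => ?_
    have hgt := (hg.differentiable one_ne_zero (t • w)).hasFDerivAt.comp w
      ((hasFDerivAt_id w).const_smul t)
    refine (hgt.const_smul (t ^ m)).congr_fderiv ?_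
    ext y
    simp [pow_succ, mul_smul]

theorem fderiv_radialMean_apply [FiniteDimensional ℝ E] {g : E → F}
    (hg : ContDiff ℝ 1 g) (m : ℕ) (v y : E) :
    fderiv ℝ (radialMean m g) v y = radialMean (m + 1) (fun w => fderiv ℝ g w y) v := by
  rw [(hasFDerivAt_radialMean hg m v).fderiv,
    radialMean_clm_apply (hg.continuous_fderiv one_ne_zero)]

theorem contDiff_radialMean [FiniteDimensional ℝ E] {n : ℕ∞} {g : E → F}
    (hg : ContDiff ℝ n g) (m : ℕ) : ContDiff ℝ n (radialMean m g) := by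
  rw [contDiff_iff_forall_nat_le] at hg ⊢
  intro k hk
  specialize hg k hk
  clear hk
  induction k generalizing m g with
  | zero => exact contDiff_zero.2 (continuous_radialMean hg.continuous m)
  | succ k ih =>
    have hg1 : ContDiff ℝ 1 g := hg.of_le (mod_cast Nat.le_add_left 1 k)
    rw [Nat.cast_add, Nat.cast_one] at hg ⊢
    refine contDiff_succ_iff_fderiv_apply.2
      ⟨fun v => (hasFDerivAt_radialMean hg1 m v).differentiableAt, fun h => by simp at h,
        fun y => ?_⟩
    simp_rw [fderiv_radialMean_apply hg1]
    exact ih _ ((hg.fderiv_right le_rfl).clm_apply contDiff_const)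

theorem eq_add_radialMean_fderiv [CompleteSpace F] {f : E → F} (hf : ContDiff ℝ 1 f) (v : E) :
    f v = f 0 + radialMean 0 (fderiv ℝ f) v v := by
  have hf' : Continuous (fderiv ℝ f) := hf.continuous_fderiv one_ne_zero
  have hderiv : ∀ t : ℝ, HasDerivAt (fun t : ℝ => f (t • v)) (fderiv ℝ f (t • v) v) t := fun t =>
    (hf.differentiable one_ne_zero (t • v)).hasFDerivAt.comp_hasDerivAt t
      (by simpa using (hasDerivAt_id t).smul_const v)
  have hFTC := intervalIntegral.integral_eq_sub_of_hasDerivAt (a := 0) (b := 1)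
    (fun t _ => hderiv t) (Continuous.intervalIntegrable (by fun_prop) _ _)
  rw [← radialMean_clm_apply hf', ← sub_eq_iff_eq_add']
  simpa [radialMean] using hFTC.symm

end SmoothFunctions

theorem finsupp_induction_add_single {σ : Type*} {P : (σ →₀ ℕ) → Prop} (zero : P 0)
    (add_single : ∀ α i, P α → P (α + Finsupp.single i 1)) (α : σ →₀ ℕ) : P α := by
  suffices ∀ β, P β → P (β + α) by simpa using this 0 zero
  induction α using Finsupp.induction_linear with
  | zero => simp
  | add α γ hα hγ => exact fun β hβ => add_assoc β α γ ▸ hγ _ (hα β hβ)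
  | single i n =>
    intro β hβ
    induction n with
    | zero => simpa using hβ
    | succ n ih => simpa only [Finsupp.single_add, ← add_assoc] using add_single _ i ih

section TaylorSeries

variable {f g : Plane → ℝ}

theorem contDiff_partialD (hf : ContDiff ℝ ∞ f) (i : Fin 2) : ContDiff ℝ ∞ (partialD i f) :=
  (hf.fderiv_right (m := ∞) (by simp)).clm_apply contDiff_const

theorem contDiff_partialD_iterate (hf : ContDiff ℝ ∞ f) (i : Fin 2) (n : ℕ) :
    ContDiff ℝ ∞ ((partialD i)^[n] f) := by
  induction n with
  | zero => exact hf
  | succ n ih => rw [Function.iterate_succ_apply']; exact contDiff_partialD ih i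

theorem partialD_const (i : Fin 2) (c : ℝ) : partialD i (fun _ => c) = 0 := by
  ext v
  simp [partialD]

theorem partialD_coord (i j : Fin 2) :
    partialD i (fun v => v j) = fun _ => (Pi.single i 1 : Plane) j := by
  ext v
  simp [partialD, (hasFDerivAt_apply (𝕜 := ℝ) j v).fderiv]

theorem partialD_add (hf : Differentiable ℝ f) (hg : Differentiable ℝ g) (i : Fin 2) :
    partialD i (f + g) = partialD i f + partialD i g := by
  ext v
  simp [partialD, fderiv_add (hf v) (hg v)]

theorem partialD_mul (hf : Differentiable ℝ f) (hg : Differentiable ℝ g) (i : Fin 2) :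
    partialD i (f * g) = f * partialD i g + g * partialD i f := by
  ext v
  simp [partialD, fderiv_mul (hf v) (hg v)]

theorem partialD_comm (hf : ContDiff ℝ ∞ f) (i j : Fin 2) :
    partialD i (partialD j f) = partialD j (partialD i f) := by
  have snd_fderiv (i j : Fin 2) (v : Plane) : partialD i (partialD j f) v =
      fderiv ℝ (fderiv ℝ f) v (Pi.single i 1) (Pi.single j 1) := by
    have hf' : DifferentiableAt ℝ (fderiv ℝ f) v :=
      (hf.fderiv_right (m := ∞) (by simp)).differentiable (by simp) v
    change fderiv ℝ (fun w => fderiv ℝ f w (Pi.single j 1)) v (Pi.single i 1) = _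
    simp [fderiv_clm_apply hf' (differentiableAt_const _)]
  ext v
  rw [snd_fderiv, snd_fderiv]
  exact (hf.contDiffAt (x := v)).isSymmSndFDerivAt
    (by simpa using WithTop.coe_le_coe.2 (le_top (a := (2 : ℕ∞)))) _ _

theorem partialD_iterate_comm (hf : ContDiff ℝ ∞ f) (i j : Fin 2) (n : ℕ) :
    (partialD i)^[n] (partialD j f) = partialD j ((partialD i)^[n] f) := by
  induction n with
  | zero => rfl
  | succ n ih =>
    rw [Function.iterate_succ_apply', Function.iterate_succ_apply', ih,
      partialD_comm (contDiff_partialD_iterate hf i n)]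

theorem partialD_iterate_add (hf : ContDiff ℝ ∞ f) (hg : ContDiff ℝ ∞ g) (i : Fin 2) (n : ℕ) :
    (partialD i)^[n] (f + g) = (partialD i)^[n] f + (partialD i)^[n] g := by
  induction n with
  | zero => rfl
  | succ n ih =>
    simp only [Function.iterate_succ_apply', ih]
    exact partialD_add ((contDiff_partialD_iterate hf i n).differentiable (by simp))
      ((contDiff_partialD_iterate hg i n).differentiable (by simp)) i

theorem partialD_iterate_radialMean (hf : ContDiff ℝ ∞ f) (m n : ℕ) (i : Fin 2) :
    (partialD i)^[n] (radialMean m f) = radialMean (m + n) ((partialD i)^[n] f) := by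
  induction n with
  | zero => rfl
  | succ n ih =>
    rw [Function.iterate_succ_apply', Function.iterate_succ_apply', ih]
    exact funext fun v => fderiv_radialMean_apply
      ((contDiff_partialD_iterate hf i n).of_le (by simp)) _ v _

/-- The Taylor series of `f` at the origin. If `f` is smooth, this is the `infJet` of its germ. -/
noncomputable def taylorSeries (f : Plane → ℝ) : MvPowerSeries (Fin 2) ℝ := fun α =>
  (partialD 0)^[α 0] ((partialD 1)^[α 1] f) 0 / (((α 0).factorial : ℝ) * (α 1).factorial)

theorem coeff_taylorSeries (f : Plane → ℝ) (α : Expo) :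
    MvPowerSeries.coeff α (taylorSeries f) =
      (partialD 0)^[α 0] ((partialD 1)^[α 1] f) 0 /
        (((α 0).factorial : ℝ) * (α 1).factorial) := rfl

theorem constantCoeff_taylorSeries (f : Plane → ℝ) :
    MvPowerSeries.constantCoeff (taylorSeries f) = f 0 := by
  simp [← MvPowerSeries.coeff_zero_eq_constantCoeff_apply, coeff_taylorSeries]

theorem taylorSeries_partialD (hf : ContDiff ℝ ∞ f) (i : Fin 2) :
    taylorSeries (partialD i f) = MvPowerSeries.pderiv ℝ i (taylorSeries f) := by
  ext α
  rw [MvPowerSeries.coeff_pderiv, coeff_taylorSeries, coeff_taylorSeries]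
  fin_cases i <;>
  · simp only [Fin.zero_eta, Fin.mk_one, Finsupp.add_apply, Finsupp.single_eq_same,
      Finsupp.single_eq_of_ne, ne_eq, zero_ne_one, one_ne_zero, not_false_eq_true, add_zero,
      partialD_iterate_comm hf, Function.iterate_succ_apply, Nat.factorial_succ, Nat.cast_mul,
      Nat.cast_succ]
    field_simp

theorem taylorSeries_const (c : ℝ) : taylorSeries (fun _ => c) = MvPowerSeries.C c := by
  have taylorSeries_zero : taylorSeries 0 = 0 := by
    ext α
    have iterate_zero (i : Fin 2) (n : ℕ) : (partialD i)^[n] 0 = 0 :=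
      Function.iterate_fixed (partialD_const i 0) n
    simp [coeff_taylorSeries, iterate_zero]
  refine MvPowerSeries.pderiv.ext (fun i => ?_) ?_
  · rw [← taylorSeries_partialD contDiff_const, partialD_const, taylorSeries_zero,
      MvPowerSeries.pderiv_C]
  · rw [constantCoeff_taylorSeries, MvPowerSeries.constantCoeff_C]

theorem taylorSeries_coord (j : Fin 2) : taylorSeries (fun v => v j) = MvPowerSeries.X j := by
  refine MvPowerSeries.pderiv.ext (fun i => ?_) ?_
  · rw [← taylorSeries_partialD (contDiff_apply ℝ ℝ j), partialD_coord, taylorSeries_const]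
    rcases eq_or_ne j i with rfl | hij
    · simp
    · rw [MvPowerSeries.pderiv_X_of_ne hij, Pi.single_eq_of_ne hij, map_zero]
  · simp [constantCoeff_taylorSeries]

theorem taylorSeries_add (hf : ContDiff ℝ ∞ f) (hg : ContDiff ℝ ∞ g) :
    taylorSeries (f + g) = taylorSeries f + taylorSeries g := by
  ext α
  simp only [map_add, coeff_taylorSeries, partialD_iterate_add hf hg, partialD_iterate_add
    (contDiff_partialD_iterate hf _ _) (contDiff_partialD_iterate hg _ _), Pi.add_apply, add_div]

theorem taylorSeries_mul (hf : ContDiff ℝ ∞ f) (hg : ContDiff ℝ ∞ g) :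
    taylorSeries (f * g) = taylorSeries f * taylorSeries g := by
  ext α
  induction α using finsupp_induction_add_single generalizing f g with
  | zero => simp [constantCoeff_taylorSeries]
  | add_single α i ih =>
    refine mul_right_cancel₀ (b := (α i : ℝ) + 1) (by positivity) ?_
    have hf' := contDiff_partialD hf i
    have hg' := contDiff_partialD hg i
    have hfg : ContDiff ℝ ∞ (f * g) := hf.mul hg
    have hfg' : ContDiff ℝ ∞ (f * partialD i g) := hf.mul hg'
    have hgf' : ContDiff ℝ ∞ (g * partialD i f) := hg.mul hf'
    calc MvPowerSeries.coeff (α + Finsupp.single i 1) (taylorSeries (f * g)) * (α i + 1)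
        = MvPowerSeries.coeff α (taylorSeries (f * partialD i g + g * partialD i f)) := by
          rw [← MvPowerSeries.coeff_pderiv, ← taylorSeries_partialD hfg,
            partialD_mul (hf.differentiable (by simp)) (hg.differentiable (by simp))]
      _ = MvPowerSeries.coeff α (taylorSeries f * taylorSeries (partialD i g) +
            taylorSeries g * taylorSeries (partialD i f)) := by
          rw [taylorSeries_add hfg' hgf', map_add, map_add, ih hf hg', ih hg hf']
      _ = _ := by
          rw [← MvPowerSeries.coeff_pderiv, Derivation.leibniz, smul_eq_mul, smul_eq_mul,
            taylorSeries_partialD hf, taylorSeries_partialD hg]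

theorem coeff_taylorSeries_radialMean (hf : ContDiff ℝ ∞ f) (α : Expo) :
    MvPowerSeries.coeff α (taylorSeries (radialMean 0 f)) =
      MvPowerSeries.coeff α (taylorSeries f) / (α.degree + 1) := by
  rw [coeff_taylorSeries, coeff_taylorSeries, partialD_iterate_radialMean hf,
    partialD_iterate_radialMean (contDiff_partialD_iterate hf 1 _), radialMean_apply_zero,
    Finsupp.degree_eq_sum, Fin.sum_univ_two, smul_eq_mul]
  push_cast
  rw [zero_add, add_comm (α 0 : ℝ), inv_mul_eq_div, div_right_comm]

theorem eq_add_sum_mul_radialMean_partialD (hf : ContDiff ℝ ∞ f) (v : Plane) :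
    f v = f 0 + ∑ i, v i * radialMean 0 (partialD i f) v := by
  have hf1 : ContDiff ℝ 1 f := hf.of_le (by simp)
  have hf' : Continuous (fderiv ℝ f) := hf1.continuous_fderiv one_ne_zero
  calc f v = f 0 + radialMean 0 (fderiv ℝ f) v (∑ i, v i • Pi.single i 1) := by
        rw [← pi_eq_sum_univ' v]; exact eq_add_radialMean_fderiv hf1 v
    _ = f 0 + ∑ i, v i * radialMean 0 (partialD i f) v := by
        simp_rw [map_sum, map_smul, ← radialMean_clm_apply hf', smul_eq_mul]
        rfl

end TaylorSeries

section Jets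

/-- The germ at the origin of a function that is smooth on the whole plane. -/
noncomputable def germOf (f : Plane → ℝ) (hf : ContDiff ℝ ∞ f) : SmoothGerm :=
  ⟨(f : Germ (𝓝 (0 : Plane)) ℝ), f, .of_forall fun _ => hf.contDiffAt, rfl⟩

theorem exists_germOf_eq (u : SmoothGerm) : ∃ f, ∃ hf : ContDiff ℝ ∞ f, germOf f hf = u := by
  obtain ⟨_, f, hf, rfl⟩ := u
  obtain ⟨g, hg, hgf⟩ := exists_contDiff_eventuallyEq hf
  exact ⟨g, hg, Subtype.ext (Germ.coe_eq.2 hgf)⟩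

/-- Taylor expansion at the origin, as a ring homomorphism. -/
noncomputable def jet : SmoothGerm →+* MvPowerSeries (Fin 2) ℝ where
  toFun := infJet
  map_one' := taylorSeries_const 1
  map_zero' := (taylorSeries_const 0).trans (map_zero _)
  map_mul' u w := by
    obtain ⟨f, hf, rfl⟩ := exists_germOf_eq u
    obtain ⟨g, hg, rfl⟩ := exists_germOf_eq w
    exact taylorSeries_mul hf hg
  map_add' u w := by
    obtain ⟨f, hf, rfl⟩ := exists_germOf_eq u
    obtain ⟨g, hg, rfl⟩ := exists_germOf_eq w
    exact taylorSeries_add hf hg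

theorem jet_germOf {f : Plane → ℝ} (hf : ContDiff ℝ ∞ f) : jet (germOf f hf) = taylorSeries f :=
  rfl

theorem coeff_jet (u : SmoothGerm) (α : Expo) :
    MvPowerSeries.coeff α (jet u) = taylorCoeff u α := rfl

theorem isFlat_sub_iff {u w : SmoothGerm} : IsFlat (u - w) ↔ infJet u = infJet w := by
  change jet (u - w) = 0 ↔ jet u = jet w
  rw [map_sub, sub_eq_zero]

/-- `polyGerm` as a ring homomorphism. -/
noncomputable def polyGermHom : MvPolynomial (Fin 2) ℝ →+* SmoothGerm where
  toFun := polyGerm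
  map_one' := Subtype.ext (by simp [polyGerm]; rfl)
  map_zero' := Subtype.ext (by simp [polyGerm]; rfl)
  map_mul' p q := Subtype.ext (by simp [polyGerm]; rfl)
  map_add' p q := Subtype.ext (by simp [polyGerm]; rfl)

theorem polyGerm_zero : polyGerm 0 = 0 := map_zero polyGermHom

theorem polyGerm_sub (p q : MvPolynomial (Fin 2) ℝ) :
    polyGerm (p - q) = polyGerm p - polyGerm q := map_sub polyGermHom p q

theorem jet_comp_polyGermHom :
    jet.comp polyGermHom = MvPolynomial.coeToMvPowerSeries.ringHom := by
  refine MvPolynomial.ringHom_ext (fun c => ?_) (fun i => ?_)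
  · have polyGerm_C : polyGerm (MvPolynomial.C c) = germOf (fun _ => c) contDiff_const :=
      Subtype.ext (by simp [polyGerm, germOf])
    change jet (polyGerm _) = _
    rw [polyGerm_C, jet_germOf, taylorSeries_const]
    simp
  · have polyGerm_X : polyGerm (MvPolynomial.X i) =
        germOf (fun v => v i) (contDiff_apply ℝ ℝ i) :=
      Subtype.ext (by simp [polyGerm, germOf])
    change jet (polyGerm _) = _
    rw [polyGerm_X, jet_germOf, taylorSeries_coord]
    simp

theorem jet_polyGerm (p : MvPolynomial (Fin 2) ℝ) :
    jet (polyGerm p) = (p : MvPowerSeries (Fin 2) ℝ) :=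
  congrArg (fun φ => φ p) jet_comp_polyGermHom

theorem taylorCoeff_polyGerm (p : MvPolynomial (Fin 2) ℝ) (α : Expo) :
    taylorCoeff (polyGerm p) α = p.coeff α := by
  rw [← coeff_jet, jet_polyGerm, MvPolynomial.coeff_coe]

theorem infJet_polyGerm_injective : Function.Injective fun p => infJet (polyGerm p) :=
  fun p q hpq => MvPolynomial.ext p q fun α => by
    simpa only [infJet, taylorCoeff_polyGerm] using congrFun hpq α

/-- The exponents of the monomials that occur in the Taylor series of `u`. -/
def jetSupport (u : SmoothGerm) : Set Expo := Function.support (taylorCoeff u)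

theorem mem_jetSupport {u : SmoothGerm} {α : Expo} : α ∈ jetSupport u ↔ taylorCoeff u α ≠ 0 :=
  Iff.rfl

theorem jetSupport_polyGerm (p : MvPolynomial (Fin 2) ℝ) :
    jetSupport (polyGerm p) = p.support := by
  ext α
  rw [mem_jetSupport, taylorCoeff_polyGerm, Finset.mem_coe, MvPolynomial.mem_support_iff]

theorem isFlat_iff_jetSupport_eq_empty {u : SmoothGerm} : IsFlat u ↔ jetSupport u = ∅ :=
  Function.support_eq_empty_iff.symm

theorem jetSupport_zero : jetSupport 0 = ∅ := isFlat_iff_jetSupport_eq_empty.1 (map_zero jet)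

theorem taylorCoeff_add (u w : SmoothGerm) :
    taylorCoeff (u + w) = taylorCoeff u + taylorCoeff w := map_add jet u w

theorem taylorCoeff_sub (u w : SmoothGerm) :
    taylorCoeff (u - w) = taylorCoeff u - taylorCoeff w := map_sub jet u w

theorem jetSupport_add_subset (u w : SmoothGerm) :
    jetSupport (u + w) ⊆ jetSupport u ∪ jetSupport w := by
  rw [jetSupport, taylorCoeff_add]
  exact Function.support_add _ _

theorem jetSupport_sub_subset (u w : SmoothGerm) :
    jetSupport (u - w) ⊆ jetSupport u ∪ jetSupport w := by
  rw [jetSupport, taylorCoeff_sub]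
  exact Function.support_sub _ _

open scoped Pointwise in
theorem jetSupport_mul_subset (u w : SmoothGerm) :
    jetSupport (u * w) ⊆ jetSupport u + jetSupport w := by
  classical
  intro α hα
  rw [mem_jetSupport, ← coeff_jet, map_mul, MvPowerSeries.coeff_mul] at hα
  obtain ⟨⟨β, γ⟩, hβγ, hne⟩ := Finset.exists_ne_zero_of_sum_ne_zero hα
  exact ⟨β, left_ne_zero_of_mul hne, γ, right_ne_zero_of_mul hne,
    Finset.HasAntidiagonal.mem_antidiagonal.1 hβγ⟩

/-- The germ of the term `c X^α`. -/
noncomputable abbrev termGerm (α : Expo) (c : ℝ) : SmoothGerm :=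
  polyGerm (MvPolynomial.monomial α c)

theorem taylorCoeff_termGerm_self (α : Expo) (c : ℝ) : taylorCoeff (termGerm α c) α = c := by
  rw [taylorCoeff_polyGerm, MvPolynomial.coeff_monomial, if_pos rfl]

theorem jetSupport_termGerm_subset (α : Expo) (c : ℝ) : jetSupport (termGerm α c) ⊆ {α} := by
  rw [jetSupport_polyGerm]
  exact_mod_cast MvPolynomial.support_monomial_subset

theorem termGerm_mul_termGerm (α β : Expo) (c d : ℝ) :
    termGerm α c * termGerm β d = termGerm (α + β) (c * d) := by
  rw [termGerm, termGerm, termGerm, ← MvPolynomial.monomial_mul]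
  exact (map_mul polyGermHom _ _).symm

theorem taylorCoeff_termGerm_mul (γ : Expo) (c : ℝ) (u : SmoothGerm) (α : Expo) :
    taylorCoeff (termGerm γ c * u) (γ + α) = c * taylorCoeff u α := by
  classical
  rw [← coeff_jet, map_mul, jet_polyGerm, MvPolynomial.coe_monomial,
    MvPowerSeries.coeff_add_monomial_mul, coeff_jet]

/-- The ideal of germs all of whose Taylor monomials have their exponents in the upper set `s`. -/
noncomputable def supportIdeal (s : Set Expo) (hs : IsUpperSet s) : Ideal SmoothGerm where
  carrier := {u | jetSupport u ⊆ s}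
  zero_mem' := by simp [jetSupport_zero]
  add_mem' hu hw := (jetSupport_add_subset _ _).trans (Set.union_subset hu hw)
  smul_mem' c u hu := (jetSupport_mul_subset c u).trans <| by
    rintro _ ⟨β, -, γ, hγ, rfl⟩
    exact hs le_add_self (hu hγ)

theorem mem_supportIdeal {s : Set Expo} {hs : IsUpperSet s} {u : SmoothGerm} :
    u ∈ supportIdeal s hs ↔ jetSupport u ⊆ s := Iff.rfl

end Jets

section MaximalIdeal

theorem isUnit_of_taylorCoeff_zero_ne_zero {u : SmoothGerm} (hu : taylorCoeff u 0 ≠ 0) :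
    IsUnit u := by
  obtain ⟨f, hf, rfl⟩ := exists_germOf_eq u
  rw [← coeff_jet, MvPowerSeries.coeff_zero_eq_constantCoeff_apply, jet_germOf,
    constantCoeff_taylorSeries] at hu
  have hne : ∀ᶠ v in 𝓝 (0 : Plane), f v ≠ 0 := hf.continuous.continuousAt.eventually_ne hu
  refine IsUnit.of_mul_eq_one ⟨(fun v => (f v)⁻¹ : Plane → ℝ), _, ?_, rfl⟩
    (Subtype.ext (Germ.coe_eq.2 ?_))
  · filter_upwards [hne] with v hv using hf.contDiffAt.inv hv
  · filter_upwards [hne] with v hv using mul_inv_cancel₀ hv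

theorem exists_eq_sum_X_mul {u : SmoothGerm} (hu : 0 ∉ jetSupport u) :
    ∃ w : Fin 2 → SmoothGerm, u = ∑ i, polyGerm (MvPolynomial.X i) * w i ∧
      ∀ i, ∀ α ∈ jetSupport (w i), α + Finsupp.single i 1 ∈ jetSupport u := by
  obtain ⟨f, hf, rfl⟩ := exists_germOf_eq u
  have hf0 : f 0 = 0 := by
    rwa [mem_jetSupport, not_not, ← coeff_jet, MvPowerSeries.coeff_zero_eq_constantCoeff_apply,
      jet_germOf, constantCoeff_taylorSeries] at hu
  refine ⟨fun i => germOf (radialMean 0 (partialD i f))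
    (contDiff_radialMean (contDiff_partialD hf i) 0), ?_, fun i α hα => ?_⟩
  · have hadamard : f = fun v => v 0 * radialMean 0 (partialD 0 f) v +
        v 1 * radialMean 0 (partialD 1 f) v := funext fun v => by
      simpa [hf0] using eq_add_sum_mul_radialMean_partialD hf v
    rw [Fin.sum_univ_two]
    refine Subtype.ext (Germ.coe_eq.2 (.of_forall fun v => ?_))
    simpa using congrFun hadamard v
  · rw [mem_jetSupport, ← coeff_jet, jet_germOf] at hα ⊢
    rw [coeff_taylorSeries_radialMean (contDiff_partialD hf i), taylorSeries_partialD hf,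
      MvPowerSeries.coeff_pderiv] at hα
    exact left_ne_zero_of_mul (div_ne_zero_iff.1 hα).1

theorem polyGerm_X_mem_maxIdeal (i : Fin 2) : polyGerm (MvPolynomial.X i) ∈ maxIdeal :=
  Ideal.subset_span (by fin_cases i <;> simp)

theorem isUpperSet_le_degree (n : ℕ) : IsUpperSet {α : Expo | n ≤ α.degree} :=
  fun _ _ hαβ hα => hα.trans (Finsupp.degree_mono hαβ)

open scoped Pointwise in
theorem supportIdeal_mul_le {s t u : Set Expo} (hs : IsUpperSet s) (ht : IsUpperSet t)
    (hu : IsUpperSet u) (hstu : s + t ⊆ u) :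
    supportIdeal s hs * supportIdeal t ht ≤ supportIdeal u hu :=
  Ideal.mul_le.2 fun a ha b hb =>
    (jetSupport_mul_subset a b).trans ((Set.add_subset_add ha hb).trans hstu)

theorem supportIdeal_le_maxIdeal_mul {s t : Set Expo} (hs : IsUpperSet s) (ht : IsUpperSet t)
    (hs0 : 0 ∉ s) (hst : ∀ α i, α + Finsupp.single i 1 ∈ s → α ∈ t) :
    supportIdeal s hs ≤ maxIdeal * supportIdeal t ht := by
  intro u hu
  obtain ⟨w, rfl, hw⟩ := exists_eq_sum_X_mul fun h => hs0 (hu h)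
  exact sum_mem fun i _ => Ideal.mul_mem_mul (polyGerm_X_mem_maxIdeal i)
    fun α hα => hst α i (hu (hw i α hα))

theorem maxIdeal_le_supportIdeal :
    maxIdeal ≤ supportIdeal {α | 1 ≤ α.degree} (isUpperSet_le_degree 1) := by
  have X_mem (i : Fin 2) : polyGerm (MvPolynomial.X i) ∈
      supportIdeal {α | 1 ≤ α.degree} (isUpperSet_le_degree 1) := fun α hα => by
    rw [Set.mem_singleton_iff.1 (jetSupport_termGerm_subset _ _ hα), Set.mem_ofPred_eq,
      Finsupp.degree_single]
  refine Ideal.span_le.2 ?_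
  rintro _ (rfl | rfl)
  exacts [X_mem 0, X_mem 1]

theorem maxIdeal_pow_eq_supportIdeal (n : ℕ) :
    maxIdeal ^ n = supportIdeal {α | n ≤ α.degree} (isUpperSet_le_degree n) := by
  induction n with
  | zero => exact le_antisymm (fun u _ α _ => α.degree.zero_le) (by simp)
  | succ n ih =>
    rw [pow_succ', ih]
    refine le_antisymm ?_ ?_
    · refine (Ideal.mul_mono_left maxIdeal_le_supportIdeal).trans
        (supportIdeal_mul_le _ _ _ (Set.add_subset_iff.2 fun α hα β hβ => ?_))
      rw [Set.mem_ofPred_eq] at *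
      rw [map_add]
      omega
    · refine supportIdeal_le_maxIdeal_mul _ _ (by simp) fun α i hα => ?_
      simpa [Finsupp.degree_single] using hα

theorem mem_maxIdeal_pow {n : ℕ} {u : SmoothGerm} :
    u ∈ maxIdeal ^ n ↔ ∀ α ∈ jetSupport u, n ≤ α.degree := by
  rw [maxIdeal_pow_eq_supportIdeal]
  rfl

theorem termGerm_mem_maxIdeal_pow {n : ℕ} {α : Expo} (hα : n ≤ α.degree) (c : ℝ) :
    termGerm α c ∈ maxIdeal ^ n :=
  mem_maxIdeal_pow.2 fun _ hβ => jetSupport_termGerm_subset α c hβ ▸ hα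

theorem sub_polyGerm_truncTotal_mem (u : SmoothGerm) (n : ℕ) :
    u - polyGerm ((jet u).truncTotal n) ∈ maxIdeal ^ n := by
  refine mem_maxIdeal_pow.2 fun α hα => not_lt.1 fun hαn => hα ?_
  rw [taylorCoeff_sub, Pi.sub_apply, taylorCoeff_polyGerm, MvPowerSeries.coeff_truncTotal _ hαn,
    coeff_jet, sub_self]

theorem maxIdeal_le_jacobson_bot : maxIdeal ≤ Ideal.jacobson ⊥ := by
  intro u hu
  refine Ideal.mem_jacobson_bot.2 fun y => isUnit_of_taylorCoeff_zero_ne_zero ?_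
  have huy : taylorCoeff (u * y) 0 = 0 := by
    by_contra h
    have hmem : u * y ∈ maxIdeal ^ 1 := by simpa using maxIdeal.mul_mem_right y hu
    simpa using mem_maxIdeal_pow.1 hmem 0 h
  rw [taylorCoeff_add, Pi.add_apply, huy, ← coeff_jet 1, map_one]
  simp

/-- The ideal of flat germs. -/
noncomputable def flatIdeal : Ideal SmoothGerm := supportIdeal ∅ isUpperSet_empty

theorem mem_flatIdeal {u : SmoothGerm} : u ∈ flatIdeal ↔ IsFlat u := by
  rw [isFlat_iff_jetSupport_eq_empty, ← Set.subset_empty_iff]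
  rfl

theorem le_pow_mul_of_le_mul {R : Type*} [CommSemiring R] {I J : Ideal R} (h : J ≤ I * J)
    (n : ℕ) : J ≤ I ^ n * J := by
  induction n with
  | zero => simp
  | succ n ih =>
    calc J ≤ I * J := h
      _ ≤ I * (I ^ n * J) := Ideal.mul_mono_right ih
      _ = I ^ (n + 1) * J := by rw [pow_succ', mul_assoc]

theorem flatIdeal_le_maxIdeal_pow_mul (n : ℕ) : flatIdeal ≤ maxIdeal ^ n * flatIdeal :=
  le_pow_mul_of_le_mul
    (supportIdeal_le_maxIdeal_mul _ _ (Set.notMem_empty _) fun _ _ => False.elim) n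

end MaximalIdeal

section LocalOrder

variable {r : Expo → Expo → Prop}

/-- The exponents `α` with `X^α ≼ X^β`. -/
def exposLE (r : Expo → Expo → Prop) (β : Expo) : Set Expo := {α | α = β ∨ r α β}

theorem self_mem_exposLE (β : Expo) : β ∈ exposLE r β := Or.inl rfl

namespace IsLocalOrder

theorem not_lt_of_mem_exposLE (hr : IsLocalOrder r) {α β : Expo} (hαβ : α ∈ exposLE r β) :
    ¬ r β α := by
  rcases hαβ with rfl | hαβ
  · exact hr.strictTotal.irrefl α
  · exact fun hβα => hr.strictTotal.irrefl α (hr.strictTotal.trans _ _ _ hαβ hβα)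

theorem mem_exposLE_of_not_lt (hr : IsLocalOrder r) {α β : Expo} (hαβ : ¬ r β α) :
    α ∈ exposLE r β :=
  have := hr.strictTotal
  (trichotomous_of r α β).elim Or.inr fun h => h.imp_right fun hβα => absurd hβα hαβ

theorem exposLE_subset (hr : IsLocalOrder r) {α β : Expo} (hαβ : α ∈ exposLE r β) :
    exposLE r α ⊆ exposLE r β := by
  rintro γ (rfl | hγα)
  · exact hαβ
  · rcases hαβ with rfl | hαβ
    exacts [Or.inr hγα, Or.inr (hr.strictTotal.trans _ _ _ hγα hαβ)]

theorem exposLE_antisymm (hr : IsLocalOrder r) {α β : Expo} (hαβ : α ∈ exposLE r β)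
    (hβα : β ∈ exposLE r α) : α = β :=
  hαβ.resolve_right (hr.not_lt_of_mem_exposLE hβα)

theorem add_left_mem_exposLE (hr : IsLocalOrder r) {α β : Expo} (hαβ : α ∈ exposLE r β)
    (γ : Expo) : γ + α ∈ exposLE r (γ + β) := by
  rw [add_comm γ, add_comm γ]
  exact hαβ.imp (congrArg (· + γ)) (hr.add_right α β γ)

theorem mem_exposLE_of_le (hr : IsLocalOrder r) {α β : Expo} (hαβ : α ≤ β) :
    β ∈ exposLE r α := by
  obtain ⟨γ, rfl⟩ := exists_add_of_le hαβ
  induction γ using finsupp_induction_add_single with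
  | zero => exact Or.inl (add_zero α)
  | add_single γ i ih =>
    refine hr.exposLE_subset (ih le_self_add) ?_
    simpa [add_assoc] using hr.add_left_mem_exposLE (Or.inr (hr.var_lt_one i)) (α + γ)

theorem isUpperSet_exposLE (hr : IsLocalOrder r) (β : Expo) : IsUpperSet (exposLE r β) :=
  fun _ _ hαγ hα => hr.exposLE_subset hα (hr.mem_exposLE_of_le hαγ)

/-- An infinite `≺`-increasing sequence would contain, by Dickson's lemma, two terms one of which
divides a later, hence `≺`-larger, one. -/
theorem wellFounded_swap (hr : IsLocalOrder r) : WellFounded (Function.swap r) := by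
  have : IsStrictOrder Expo (Function.swap r) :=
    { irrefl := hr.strictTotal.irrefl
      trans := fun _ _ _ hba hcb => hr.strictTotal.trans _ _ _ hcb hba }
  refine RelEmbedding.wellFounded_iff_isEmpty.2 ⟨fun f => ?_⟩
  obtain ⟨m, n, hmn, hle⟩ := wellQuasiOrdered_le (α := Expo) f
  exact hr.not_lt_of_mem_exposLE (hr.mem_exposLE_of_le hle) (f.map_rel_iff.2 hmn)

theorem exists_max (hr : IsLocalOrder r) {s : Set Expo} (hs : s.Nonempty) :
    ∃ β ∈ s, s ⊆ exposLE r β := by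
  obtain ⟨β, hβ, hmax⟩ := hr.wellFounded_swap.has_min s hs
  exact ⟨β, hβ, fun α hα => hr.mem_exposLE_of_not_lt (hmax α hα)⟩

end IsLocalOrder

theorem isLeadExpo_iff {f : SmoothGerm} {α : Expo} :
    IsLeadExpo r f α ↔ α ∈ jetSupport f ∧ jetSupport f ⊆ exposLE r α :=
  and_congr_right fun _ => forall₂_congr fun _ _ => or_iff_not_imp_left.symm

theorem IsLocalOrder.exists_isLeadExpo (hr : IsLocalOrder r) {f : SmoothGerm} (hf : ¬ IsFlat f) :
    ∃ α, IsLeadExpo r f α := by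
  rw [isFlat_iff_jetSupport_eq_empty, ← ne_eq, ← Set.nonempty_iff_ne_empty] at hf
  simpa only [isLeadExpo_iff] using hr.exists_max hf

namespace IsLeadExpo

variable {f : SmoothGerm} {α β : Expo}

theorem unique (hr : IsLocalOrder r) (hα : IsLeadExpo r f α) (hβ : IsLeadExpo r f β) : α = β := by
  rw [isLeadExpo_iff] at hα hβ
  exact hr.exposLE_antisymm (hβ.2 hα.1) (hα.2 hβ.1)

theorem leadTerm_eq (hr : IsLocalOrder r) (hα : IsLeadExpo r f α) :
    leadTerm r f = termGerm α (taylorCoeff f α) := by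
  have hex : ∃ α, IsLeadExpo r f α := ⟨α, hα⟩
  rw [leadTerm, dif_pos hex, hex.choose_spec.unique hr hα]

theorem leadCoeff_eq (hr : IsLocalOrder r) (hα : IsLeadExpo r f α) :
    leadCoeff r f = taylorCoeff f α := by
  have hex : ∃ α, IsLeadExpo r f α := ⟨α, hα⟩
  rw [leadCoeff, dif_pos hex, hex.choose_spec.unique hr hα]

theorem termGerm_mul (hr : IsLocalOrder r) (hα : IsLeadExpo r f α) (γ : Expo) {c : ℝ}
    (hc : c ≠ 0) : IsLeadExpo r (termGerm γ c * f) (γ + α) := by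
  refine isLeadExpo_iff.2 ⟨?_, (jetSupport_mul_subset _ _).trans ?_⟩
  · rw [mem_jetSupport, taylorCoeff_termGerm_mul]
    exact mul_ne_zero hc hα.1
  · rintro _ ⟨γ', hγ', δ, hδ, rfl⟩
    rw [Set.mem_singleton_iff.1 (jetSupport_termGerm_subset γ c hγ')]
    exact hr.add_left_mem_exposLE ((isLeadExpo_iff.1 hα).2 hδ) γ

end IsLeadExpo

theorem isLeadExpo_termGerm (α : Expo) {c : ℝ} (hc : c ≠ 0) : IsLeadExpo r (termGerm α c) α := by
  refine isLeadExpo_iff.2 ⟨by rwa [mem_jetSupport, taylorCoeff_termGerm_self], fun β hβ => ?_⟩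
  exact Or.inl (jetSupport_termGerm_subset α c hβ)

theorem jetSupport_leadTerm_subset (f : SmoothGerm) :
    jetSupport (leadTerm r f) ⊆ {α | IsLeadExpo r f α} := by
  unfold leadTerm
  split_ifs with hex
  · exact (jetSupport_termGerm_subset _ _).trans (Set.singleton_subset_iff.2 hex.choose_spec)
  · simp [jetSupport_zero]

/-- The exponents of the monomials divisible by the leading monomial of an element of `A`. -/
def leadExpos (r : Expo → Expo → Prop) (A : Set SmoothGerm) : Set Expo :=
  {α | ∃ g ∈ A, ∃ γ ≤ α, IsLeadExpo r g γ}

theorem isUpperSet_leadExpos (r : Expo → Expo → Prop) (A : Set SmoothGerm) :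
    IsUpperSet (leadExpos r A) :=
  fun _ _ hαβ ⟨g, hg, γ, hγα, hγ⟩ => ⟨g, hg, γ, hγα.trans hαβ, hγ⟩

theorem leadExpos_mono {A B : Set SmoothGerm} (hAB : A ⊆ B) : leadExpos r A ⊆ leadExpos r B :=
  fun _ ⟨g, hg, hα⟩ => ⟨g, hAB hg, hα⟩

theorem IsLeadExpo.mem_leadExpos {A : Set SmoothGerm} {g : SmoothGerm} {α : Expo}
    (hα : IsLeadExpo r g α) (hg : g ∈ A) : α ∈ leadExpos r A := ⟨g, hg, α, le_rfl, hα⟩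

theorem mem_leadExpos_of_le_degree {I : Ideal SmoothGerm} {n : ℕ} (hI : maxIdeal ^ n ≤ I)
    {α : Expo} (hα : n ≤ α.degree) : α ∈ leadExpos r I :=
  (isLeadExpo_termGerm α one_ne_zero).mem_leadExpos (hI (termGerm_mem_maxIdeal_pow hα 1))

theorem termGerm_mem_span_leadTerm_iff (hr : IsLocalOrder r) {A : Set SmoothGerm} {α : Expo}
    {c : ℝ} (hc : c ≠ 0) :
    termGerm α c ∈ Ideal.span {t | ∃ g ∈ A, t = leadTerm r g} ↔ α ∈ leadExpos r A := by
  constructor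
  · intro hmem
    have span_le : Ideal.span {t | ∃ g ∈ A, t = leadTerm r g} ≤
        supportIdeal (leadExpos r A) (isUpperSet_leadExpos r A) := by
      refine Ideal.span_le.2 ?_
      rintro _ ⟨g, hg, rfl⟩
      exact (jetSupport_leadTerm_subset g).trans fun γ hγ => hγ.mem_leadExpos hg
    exact span_le hmem (by rwa [mem_jetSupport, taylorCoeff_termGerm_self])
  · rintro ⟨g, hg, γ, hγα, hγ⟩
    obtain ⟨δ, rfl⟩ := exists_add_of_le hγα
    have hdvd : termGerm (γ + δ) c = leadTerm r g * termGerm δ ((taylorCoeff g γ)⁻¹ * c) := by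
      rw [hγ.leadTerm_eq hr, termGerm_mul_termGerm, mul_inv_cancel_left₀ hγ.1]
    rw [hdvd]
    exact Ideal.mul_mem_right _ _ (Ideal.subset_span ⟨g, hg, rfl⟩)

theorem leadTerm_dvd_termGerm_iff (hr : IsLocalOrder r) {g : SmoothGerm} {α : Expo} {c : ℝ}
    (hc : c ≠ 0) : leadTerm r g ∣ termGerm α c ↔ α ∈ leadExpos r {g} := by
  rw [← termGerm_mem_span_leadTerm_iff hr hc, ← Ideal.mem_span_singleton]
  simp

theorem forall_not_leadTerm_dvd_iff (hr : IsLocalOrder r) {A : Set SmoothGerm} {s : SmoothGerm} :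
    (∀ t ∈ Terms s, ∀ g ∈ A, ¬ leadTerm r g ∣ t) ↔ Disjoint (jetSupport s) (leadExpos r A) := by
  rw [Set.disjoint_left]
  constructor
  · rintro hs α hα ⟨g, hg, hgα⟩
    exact hs _ ⟨α, hα, rfl⟩ g hg ((leadTerm_dvd_termGerm_iff hr hα).2 ⟨g, rfl, hgα⟩)
  · rintro hs _ ⟨α, hα, rfl⟩ g hg hdvd
    exact hs hα (leadExpos_mono (Set.singleton_subset_iff.2 hg)
      ((leadTerm_dvd_termGerm_iff hr hα).1 hdvd))

theorem span_leadTerm_le_iff (hr : IsLocalOrder r) {A B : Set SmoothGerm} :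
    Ideal.span {t | ∃ f ∈ A, t = leadTerm r f} ≤ Ideal.span {t | ∃ g ∈ B, t = leadTerm r g} ↔
      leadExpos r A ⊆ leadExpos r B := by
  constructor
  · intro hle α hα
    rw [← termGerm_mem_span_leadTerm_iff hr one_ne_zero] at hα ⊢
    exact hle hα
  · refine fun hAB => Ideal.span_le.2 ?_
    rintro _ ⟨f, hf, rfl⟩
    by_cases hex : ∃ α, IsLeadExpo r f α
    · obtain ⟨α, hα⟩ := hex
      rw [hα.leadTerm_eq hr]
      exact (termGerm_mem_span_leadTerm_iff hr hα.1).2 (hAB (hα.mem_leadExpos hf))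
    · rw [leadTerm, dif_neg hex]
      exact zero_mem _

theorem IsLocalOrder.isFlat_of_disjoint_leadExpos (hr : IsLocalOrder r) {A : Set SmoothGerm}
    {s : SmoothGerm} (hs : s ∈ A) (hdisj : Disjoint (jetSupport s) (leadExpos r A)) :
    IsFlat s := by
  by_contra hflat
  obtain ⟨α, hα⟩ := hr.exists_isLeadExpo hflat
  exact Set.disjoint_left.1 hdisj hα.1 (hα.mem_leadExpos hs)

namespace IsStandardBasis

variable {I : Ideal SmoothGerm} {G : Finset SmoothGerm}

theorem subset (hG : IsStandardBasis r I G) : (G : Set SmoothGerm) ⊆ I :=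
  hG.span_eq ▸ Ideal.subset_span

theorem leadExpos_eq (hr : IsLocalOrder r) (hG : IsStandardBasis r I G) :
    leadExpos r G = leadExpos r I :=
  (leadExpos_mono hG.subset).antisymm ((span_leadTerm_le_iff hr).1 hG.leadIdeal_eq.le)

end IsStandardBasis

end LocalOrder

section Division

section TermwiseSpan

variable {R : Type*} [CommRing R]

/-- The elements `∑ q_g g` of the span of `G` each of whose summands `q_g g` lies in `D`. For `D`
the germs bounded by `LT(f)`, these are the combinations that a remainder of `f` may subtract. -/
def termwiseSpan (G : Set R) (D : Ideal R) : Ideal R := ⨆ g ∈ G, Ideal.span {g} ⊓ D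

theorem mul_mem_termwiseSpan {G : Set R} {D : Ideal R} {g q : R} (hg : g ∈ G) (hq : q * g ∈ D) :
    q * g ∈ termwiseSpan G D :=
  le_iSup₂ (f := fun g (_ : g ∈ G) => Ideal.span {g} ⊓ D) g hg
    ⟨Ideal.mul_mem_left _ q (Ideal.mem_span_singleton_self g), hq⟩

theorem termwiseSpan_mono_right (G : Set R) {D D' : Ideal R} (hD : D ≤ D') :
    termwiseSpan G D ≤ termwiseSpan G D' :=
  iSup₂_mono fun _ _ => inf_le_inf_left _ hD

theorem termwiseSpan_le_span (G : Set R) (D : Ideal R) : termwiseSpan G D ≤ Ideal.span G :=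
  iSup₂_le fun _ hg => inf_le_left.trans (Ideal.span_mono (Set.singleton_subset_iff.2 hg))

theorem mul_span_le_termwiseSpan (G : Set R) (D : Ideal R) :
    D * Ideal.span G ≤ termwiseSpan G D := by
  refine Ideal.mul_le.2 fun d hd u hu => ?_
  induction hu using Submodule.span_induction with
  | mem g hg => exact mul_mem_termwiseSpan hg (D.mul_mem_right g hd)
  | zero => simp
  | add u w _ _ hu hw => rw [mul_add]; exact add_mem hu hw
  | smul q u _ hu => rw [mul_smul_comm]; exact Submodule.smul_mem _ q hu

theorem exists_eq_sum_of_mem_termwiseSpan {G : Finset R} {D : Ideal R} {u : R}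
    (hu : u ∈ termwiseSpan (G : Set R) D) :
    ∃ q : R → R, (∀ g ∈ G, q g * g ∈ D) ∧ u = ∑ g ∈ G, q g * g := by
  obtain ⟨μ, rfl⟩ := (Submodule.mem_iSup_finset_iff_exists_sum _ u).1 hu
  choose q hq using fun g => Ideal.mem_span_singleton'.1 (μ g).2.1
  refine ⟨q, fun g _ => hq g ▸ (μ g).2.2, Finset.sum_congr rfl fun g _ => (hq g).symm⟩

end TermwiseSpan

/-- The germs of the polynomials without monomials with exponents in `s`. -/
noncomputable def polyOutside (s : Set Expo) : AddSubgroup SmoothGerm :=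
  (MvPolynomial.restrictSupport ℝ sᶜ).toAddSubgroup.map polyGermHom.toAddMonoidHom

theorem mem_polyOutside {s : Set Expo} {u : SmoothGerm} :
    u ∈ polyOutside s ↔ ∃ p, Disjoint (p.support : Set Expo) s ∧ polyGerm p = u := by
  simp only [← Set.subset_compl_iff_disjoint_right]
  rfl

theorem mem_of_forall_termGerm_mem {A : AddSubgroup SmoothGerm} {n : ℕ}
    (hA : (maxIdeal ^ n).toAddSubgroup ≤ A) {u : SmoothGerm}
    (hu : ∀ α ∈ jetSupport u, ∀ c ≠ 0, termGerm α c ∈ A) : u ∈ A := by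
  rw [← sub_add_cancel u (polyGerm ((jet u).truncTotal n))]
  refine add_mem (hA (sub_polyGerm_truncTotal_mem u n)) ?_
  rw [← MvPolynomial.support_sum_monomial_coeff ((jet u).truncTotal n)]
  change polyGermHom (∑ α ∈ _, _) ∈ A
  rw [map_sum]
  refine sum_mem fun α hα => ?_
  have hcoeff := MvPolynomial.mem_support_iff.1 hα
  refine hu α (mem_jetSupport.2 fun h0 => hcoeff ?_) _ hcoeff
  by_cases hαn : α.degree < n
  · rw [MvPowerSeries.coeff_truncTotal _ hαn, coeff_jet, h0]
  · exact MvPowerSeries.coeff_truncTotal_eq_zero _ (not_lt.1 hαn)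

variable {r : Expo → Expo → Prop}

theorem IsLocalOrder.induction_of_degree (hr : IsLocalOrder r) {P : Expo → Prop} (n : ℕ)
    (degree_ge : ∀ β, n ≤ β.degree → P β) (step : ∀ β, (∀ α, r α β → P α) → P β) (β : Expo) :
    P β := by
  have := hr.strictTotal
  by_cases hβ : β.degree < n
  · have hwf : {α : Expo | α.degree < n}.WellFoundedOn r :=
      (Finsupp.finite_of_degree_lt n).wellFoundedOn
    refine hwf.induction hβ fun α _ ih => step α fun γ hγα => ?_
    exact (lt_or_ge γ.degree n).elim (fun hγ => ih γ hγ hγα) (degree_ge γ)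
  · exact degree_ge β (not_lt.1 hβ)

/-- The germs that division by `G` reduces, modulo `𝓜 ^ n`, to a polynomial without monomials
divisible by a leading monomial of `G`, subtracting only multiples of elements of `G` with
monomials `≼ X^β`. -/
noncomputable def reducibleGerms (hr : IsLocalOrder r) (G : Set SmoothGerm) (n : ℕ) (β : Expo) :
    AddSubgroup SmoothGerm :=
  polyOutside (leadExpos r G) ⊔
    (termwiseSpan G (supportIdeal (exposLE r β) (hr.isUpperSet_exposLE β)) ⊔
      maxIdeal ^ n).toAddSubgroup

namespace IsLocalOrder

variable (hr : IsLocalOrder r) {G : Set SmoothGerm} {n : ℕ} {α β : Expo}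

theorem maxIdeal_pow_le_reducibleGerms :
    (maxIdeal ^ n).toAddSubgroup ≤ reducibleGerms hr G n β :=
  le_trans (fun _ hu => Ideal.mem_sup_right hu) le_sup_right

theorem reducibleGerms_mono (hαβ : α ∈ exposLE r β) :
    reducibleGerms hr G n α ≤ reducibleGerms hr G n β :=
  sup_le_sup_left (fun _ hu => sup_le_sup_right
    (termwiseSpan_mono_right G fun _ hw => Set.Subset.trans hw (hr.exposLE_subset hαβ)) _ hu) _

theorem termGerm_mem_reducibleGerms {c : ℝ} (hc : c ≠ 0) :
    termGerm β c ∈ reducibleGerms hr G n β := by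
  induction β using hr.induction_of_degree n generalizing c with
  | degree_ge β hβ =>
    exact hr.maxIdeal_pow_le_reducibleGerms (termGerm_mem_maxIdeal_pow hβ c)
  | step β ih =>
    by_cases hβ : β ∈ leadExpos r G
    · obtain ⟨g, hg, γ, hγβ, hγ⟩ := hβ
      obtain ⟨δ, rfl⟩ := le_iff_exists_add'.1 hγβ
      set w := termGerm δ (c / taylorCoeff g γ) * g with hw
      have hlead : IsLeadExpo r w (δ + γ) := hγ.termGerm_mul hr δ (div_ne_zero hc hγ.1)
      have hw_mem : w ∈ reducibleGerms hr G n (δ + γ) :=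
        (le_sup_right : _ ≤ reducibleGerms hr G n (δ + γ)) (Ideal.mem_sup_left
          (mul_mem_termwiseSpan hg (isLeadExpo_iff.1 hlead).2))
      have hcancel : taylorCoeff (termGerm (δ + γ) c - w) (δ + γ) = 0 := by
        rw [taylorCoeff_sub, Pi.sub_apply, taylorCoeff_termGerm_self, hw,
          taylorCoeff_termGerm_mul, div_mul_cancel₀ _ hγ.1, sub_self]
      rw [← sub_add_cancel (termGerm (δ + γ) c) w]
      refine add_mem (mem_of_forall_termGerm_mem hr.maxIdeal_pow_le_reducibleGerms
        fun α hα d hd => ?_) hw_mem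
      have hαδγ : α ≠ δ + γ := fun h => hα (h ▸ hcancel)
      have hrα : r α (δ + γ) := (jetSupport_sub_subset _ _ hα).elim
        (fun h => absurd (jetSupport_termGerm_subset _ _ h) hαδγ)
        (fun h => ((isLeadExpo_iff.1 hlead).2 h).resolve_left hαδγ)
      exact hr.reducibleGerms_mono (Or.inr hrα) (ih α hrα hd)
    · refine (le_sup_left : _ ≤ reducibleGerms hr G n β) (mem_polyOutside.2 ⟨_, ?_, rfl⟩)
      rw [← jetSupport_polyGerm]
      exact (Set.disjoint_singleton_left.2 hβ).mono_left (jetSupport_termGerm_subset β c)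

theorem exists_sub_polyGerm_mem (G : Set SmoothGerm) (n : ℕ) {f : SmoothGerm}
    (hf : jetSupport f ⊆ exposLE r β) :
    ∃ p : MvPolynomial (Fin 2) ℝ, Disjoint (p.support : Set Expo) (leadExpos r G) ∧
      f - polyGerm p ∈ termwiseSpan G (supportIdeal (exposLE r β) (hr.isUpperSet_exposLE β)) ⊔
        maxIdeal ^ n := by
  have hmem : f ∈ reducibleGerms hr G n β :=
    mem_of_forall_termGerm_mem hr.maxIdeal_pow_le_reducibleGerms fun α hα c hc =>
      hr.reducibleGerms_mono (hf hα) (hr.termGerm_mem_reducibleGerms hc)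
  obtain ⟨_, hp, w, hw, rfl⟩ := AddSubgroup.mem_sup.1 hmem
  obtain ⟨p, hdisj, rfl⟩ := mem_polyOutside.1 hp
  exact ⟨p, hdisj, by simpa using hw⟩

end IsLocalOrder

end Division

section StandardBasis

variable {r : Expo → Expo → Prop} {I : Ideal SmoothGerm}

theorem IsLocalOrder.eq_zero_of_disjoint_leadExpos (hr : IsLocalOrder r)
    {p : MvPolynomial (Fin 2) ℝ} (hp : polyGerm p ∈ I)
    (hdisj : Disjoint (p.support : Set Expo) (leadExpos r I)) : p = 0 := by
  rw [← jetSupport_polyGerm] at hdisj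
  have hflat : IsFlat (polyGerm p) := hr.isFlat_of_disjoint_leadExpos hp hdisj
  rw [isFlat_iff_jetSupport_eq_empty, jetSupport_polyGerm] at hflat
  exact MvPolynomial.support_eq_empty.1 (Finset.coe_eq_empty.1 hflat)

theorem IsLocalOrder.le_span_sup_maxIdeal_pow (hr : IsLocalOrder r) {G : Set SmoothGerm}
    (hGI : G ⊆ I) (hlead : leadExpos r I ⊆ leadExpos r G) {n : ℕ} (hn : maxIdeal ^ n ≤ I) :
    I ≤ Ideal.span G ⊔ maxIdeal ^ n := by
  intro f hf
  obtain ⟨p, hdisj, hp⟩ :=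
    hr.exists_sub_polyGerm_mem G n fun α _ => hr.mem_exposLE_of_le zero_le
  replace hp : f - polyGerm p ∈ Ideal.span G ⊔ maxIdeal ^ n :=
    (sup_le_sup_right (termwiseSpan_le_span G _) (maxIdeal ^ n) : _ ≤ _) hp
  have hpI : polyGerm p ∈ I := by
    simpa using sub_mem hf (sup_le (Ideal.span_le.2 hGI) hn hp)
  have hp0 : p = 0 := hr.eq_zero_of_disjoint_leadExpos hpI (hdisj.mono_right hlead)
  rwa [hp0, polyGerm_zero, sub_zero] at hp

theorem IsLocalOrder.span_eq_of_leadExpos_subset (hr : IsLocalOrder r) (hI : FiniteCodimension I)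
    {G : Set SmoothGerm} (hGI : G ⊆ I) (hlead : leadExpos r I ⊆ leadExpos r G) :
    Ideal.span G = I := by
  obtain ⟨k, hk⟩ := hI
  have maxIdeal_fg : (maxIdeal : Ideal SmoothGerm).FG := Submodule.fg_span (Set.toFinite _)
  have nakayama : maxIdeal ^ k ≤ Ideal.span G := by
    refine Submodule.le_of_le_smul_of_le_jacobson_bot maxIdeal_fg.pow maxIdeal_le_jacobson_bot ?_
    rw [smul_eq_mul, ← pow_succ']
    exact hk.trans
      (hr.le_span_sup_maxIdeal_pow hGI hlead ((Ideal.pow_le_pow_right k.le_succ).trans hk))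
  refine (Ideal.span_le.2 hGI).antisymm ?_
  simpa [sup_eq_left.2 nakayama] using hr.le_span_sup_maxIdeal_pow hGI hlead hk

theorem IsLocalOrder.isStandardBasis_of_leadExpos_subset (hr : IsLocalOrder r)
    (hI : FiniteCodimension I) {G : Finset SmoothGerm} (hGI : (G : Set SmoothGerm) ⊆ I)
    (hlead : leadExpos r I ⊆ leadExpos r (G : Set SmoothGerm)) : IsStandardBasis r I G where
  span_eq := hr.span_eq_of_leadExpos_subset hI hGI hlead
  leadIdeal_eq := ((span_leadTerm_le_iff hr).2 hlead).antisymm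
    ((span_leadTerm_le_iff hr).2 (leadExpos_mono hGI))

end StandardBasis

section ReducedStandardBasis

variable {r : Expo → Expo → Prop} {I : Ideal SmoothGerm}

/-- `g ∈ I` is the normal form of its leading monomial `X^β`: it is monic and none of its other
monomials is divisible by a leading monomial of `I`. The reduced standard bases of `I` consist of
such elements, one for each minimal `β`. -/
structure IsReducedAt (r : Expo → Expo → Prop) (I : Ideal SmoothGerm) (β : Expo)
    (g : SmoothGerm) : Prop where
  mem : g ∈ I
  taylorCoeff_eq_one : taylorCoeff g β = 1
  eq_of_mem : ∀ α ∈ jetSupport g, α ∈ leadExpos r I → α = β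

namespace IsReducedAt

variable {β : Expo} {g h : SmoothGerm}

theorem isLeadExpo (hr : IsLocalOrder r) (hg : IsReducedAt r I β g) : IsLeadExpo r g β := by
  have hflat : ¬ IsFlat g := fun hflat =>
    one_ne_zero (hg.taylorCoeff_eq_one.symm.trans (congrFun hflat β))
  obtain ⟨α, hα⟩ := hr.exists_isLeadExpo hflat
  rwa [← hg.eq_of_mem α hα.1 (hα.mem_leadExpos hg.mem)]

theorem infJet_eq (hr : IsLocalOrder r) (hg : IsReducedAt r I β g) (hh : IsReducedAt r I β h) :
    infJet g = infJet h := by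
  refine isFlat_sub_iff.1 (hr.isFlat_of_disjoint_leadExpos (sub_mem hg.mem hh.mem)
    (Set.disjoint_left.2 fun α hα hαI => hα ?_))
  obtain rfl : α = β := (jetSupport_sub_subset g h hα).elim
    (hg.eq_of_mem α · hαI) (hh.eq_of_mem α · hαI)
  rw [taylorCoeff_sub, Pi.sub_apply, hg.taylorCoeff_eq_one, hh.taylorCoeff_eq_one, sub_self]

end IsReducedAt

theorem IsLocalOrder.exists_isReducedAt_polyGerm (hr : IsLocalOrder r) (hI : FiniteCodimension I)
    {β : Expo} (hβ : β ∈ leadExpos r I) : ∃ p, IsReducedAt r I β (polyGerm p) := by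
  obtain ⟨k, hk⟩ := hI
  obtain ⟨p, hdisj, hp⟩ := hr.exists_sub_polyGerm_mem (I : Set SmoothGerm) k
    ((jetSupport_termGerm_subset β 1).trans (Set.singleton_subset_iff.2 (self_mem_exposLE β)))
  rw [← jetSupport_polyGerm, Set.disjoint_left] at hdisj
  refine ⟨MvPolynomial.monomial β 1 - p, ?_, ?_, ?_⟩ <;> rw [polyGerm_sub]
  · refine sup_le ((termwiseSpan_le_span _ _).trans ?_) hk hp
    exact (Ideal.span_eq I).le
  · have hpβ : taylorCoeff (polyGerm p) β = 0 := by
      by_contra h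
      exact hdisj h hβ
    rw [taylorCoeff_sub, Pi.sub_apply, taylorCoeff_termGerm_self, hpβ, sub_zero]
  · exact fun α hα hαI => (jetSupport_sub_subset _ _ hα).elim
      (fun h => jetSupport_termGerm_subset β 1 h) (fun h => absurd hαI (hdisj h))

namespace IsReducedStandardBasis

variable {G H : Finset SmoothGerm} {g h : SmoothGerm} {α β γ : Expo}

theorem exists_isLeadExpo (hG : IsReducedStandardBasis r I G) (hg : g ∈ G) :
    ∃ β, IsLeadExpo r g β := by
  by_contra hex
  have hcoeff := hG.leadCoeff_eq_one g hg
  rw [leadCoeff, dif_neg hex] at hcoeff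
  exact zero_ne_one hcoeff

theorem eq_of_isLeadExpo_le (hr : IsLocalOrder r) (hG : IsReducedStandardBasis r I G)
    (hg : g ∈ G) (hβ : IsLeadExpo r g β) (hh : h ∈ G) (hγ : IsLeadExpo r h γ)
    (hα : α ∈ jetSupport g) (hγα : γ ≤ α) : α = β ∧ γ = β := by
  have hdvd : leadTerm r h ∣ termGerm α (taylorCoeff g α) :=
    (leadTerm_dvd_termGerm_iff hr hα).2 ⟨h, rfl, γ, hγα, hγ⟩
  obtain ⟨rfl, hterm⟩ := not_not.1 fun hne => hG.reduced h hh g hg _ ⟨α, hα, rfl⟩ hne hdvd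
  refine ⟨?_, hγ.unique hr hβ⟩
  have hα' : α ∈ jetSupport (termGerm α (taylorCoeff h α)) :=
    (isLeadExpo_termGerm (r := r) α hα).1
  rw [termGerm, hterm, hβ.leadTerm_eq hr] at hα'
  exact jetSupport_termGerm_subset _ _ hα'

theorem isReducedAt (hr : IsLocalOrder r) (hG : IsReducedStandardBasis r I G) (hg : g ∈ G)
    (hβ : IsLeadExpo r g β) : IsReducedAt r I β g where
  mem := hG.subset hg
  taylorCoeff_eq_one := (hβ.leadCoeff_eq hr).symm.trans (hG.leadCoeff_eq_one g hg)
  eq_of_mem α hα hαI := by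
    rw [← hG.leadExpos_eq hr] at hαI
    obtain ⟨h, hh, γ, hγα, hγ⟩ := hαI
    exact (hG.eq_of_isLeadExpo_le hr hg hβ hh hγ hα hγα).1

theorem minimal_leadExpo (hr : IsLocalOrder r) (hG : IsReducedStandardBasis r I G) (hg : g ∈ G)
    (hβ : IsLeadExpo r g β) : Minimal (· ∈ leadExpos r I) β := by
  refine ⟨hβ.mem_leadExpos (hG.subset hg), fun α hαI hαβ => ?_⟩
  rw [← hG.leadExpos_eq hr] at hαI
  obtain ⟨h, hh, γ, hγα, hγ⟩ := hαI
  rwa [← (hG.eq_of_isLeadExpo_le hr hg hβ hh hγ hβ.1 (hγα.trans hαβ)).2]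

theorem exists_isReducedAt (hr : IsLocalOrder r) (hG : IsReducedStandardBasis r I G)
    (hβ : Minimal (· ∈ leadExpos r I) β) : ∃ g ∈ G, IsReducedAt r I β g := by
  obtain ⟨g, hg, γ, hγβ, hγ⟩ := (hG.leadExpos_eq hr).symm ▸ hβ.prop
  obtain rfl : γ = β := hβ.eq_of_le (hγ.mem_leadExpos (hG.subset hg)) hγβ
  exact ⟨g, hg, hG.isReducedAt hr hg hγ⟩

theorem image_infJet_subset (hr : IsLocalOrder r) (hG : IsReducedStandardBasis r I G)
    (hH : IsReducedStandardBasis r I H) :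
    infJet '' (G : Set SmoothGerm) ⊆ infJet '' (H : Set SmoothGerm) := by
  rintro _ ⟨g, hg, rfl⟩
  obtain ⟨β, hβ⟩ := hG.exists_isLeadExpo hg
  obtain ⟨h, hh, hhβ⟩ := hH.exists_isReducedAt hr (hG.minimal_leadExpo hr hg hβ)
  exact ⟨h, hh, hhβ.infJet_eq hr (hG.isReducedAt hr hg hβ)⟩

theorem image_infJet_eq (hr : IsLocalOrder r) (hG : IsReducedStandardBasis r I G)
    (hH : IsReducedStandardBasis r I H) :
    infJet '' (G : Set SmoothGerm) = infJet '' (H : Set SmoothGerm) :=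
  (hG.image_infJet_subset hr hH).antisymm (hH.image_infJet_subset hr hG)

theorem eq_of_isPolynomialGerm (hr : IsLocalOrder r) (hG : IsReducedStandardBasis r I G)
    (hH : IsReducedStandardBasis r I H) (hGp : ∀ g ∈ G, IsPolynomialGerm g)
    (hHp : ∀ h ∈ H, IsPolynomialGerm h) : G = H := by
  have infJet_injOn : Set.InjOn infJet (Set.range polyGerm) := by
    rintro _ ⟨p, rfl⟩ _ ⟨q, rfl⟩ hpq
    rw [infJet_polyGerm_injective hpq]
  exact Finset.coe_injective
    ((infJet_injOn.image_eq_image_iff hGp hHp).1 (hG.image_infJet_eq hr hH))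

end IsReducedStandardBasis

theorem isReducedStandardBasis_image (hr : IsLocalOrder r) (hI : FiniteCodimension I)
    [DecidableEq SmoothGerm] {S : Finset Expo} (hS : ∀ β, β ∈ S ↔ Minimal (· ∈ leadExpos r I) β)
    {g : Expo → SmoothGerm} (hg : ∀ β ∈ S, IsReducedAt r I β (g β)) :
    IsReducedStandardBasis r I (S.image g) where
  toIsStandardBasis := by
    refine hr.isStandardBasis_of_leadExpos_subset hI ?_ fun α hα => ?_
    · rw [Finset.coe_image, Set.image_subset_iff]
      exact fun β hβ => (hg β hβ).mem
    · obtain ⟨β, hβα, hβ⟩ := exists_minimal_le_of_wellFoundedLT (· ∈ leadExpos r I) α hα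
      rw [← hS] at hβ
      exact ⟨g β, Finset.mem_coe.2 (Finset.mem_image_of_mem g hβ), β, hβα,
        (hg β hβ).isLeadExpo hr⟩
  leadCoeff_eq_one := by
    refine Finset.forall_mem_image.2 fun β hβ => ?_
    rw [((hg β hβ).isLeadExpo hr).leadCoeff_eq hr, (hg β hβ).taylorCoeff_eq_one]
  reduced := by
    refine Finset.forall_mem_image.2 fun β hβ => Finset.forall_mem_image.2 fun γ hγ => ?_
    rintro _ ⟨α, hα, rfl⟩ hne hdvd
    obtain ⟨_, rfl, δ, hδα, hδ⟩ := (leadTerm_dvd_termGerm_iff hr hα).1 hdvd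
    obtain rfl : δ = β := hδ.unique hr ((hg β hβ).isLeadExpo hr)
    have hδI : δ ∈ leadExpos r I := ((hS δ).1 hβ).prop
    obtain rfl : α = γ := (hg γ hγ).eq_of_mem α hα (isUpperSet_leadExpos r I hδα hδI)
    obtain rfl : δ = α := ((hS α).1 hγ).eq_of_le hδI hδα
    exact hne ⟨rfl, (hδ.leadTerm_eq hr).symm⟩

theorem exists_isReducedStandardBasis_isPolynomialGerm (hr : IsLocalOrder r)
    (hI : FiniteCodimension I) :
    ∃ G : Finset SmoothGerm, IsReducedStandardBasis r I G ∧ ∀ g ∈ G, IsPolynomialGerm g := by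
  classical
  have minimal_finite : {β | Minimal (· ∈ leadExpos r I) β}.Finite :=
    WellQuasiOrderedLE.finite_of_isAntichain (setOfPred_minimal_antichain _)
  choose! p hp using fun β (hβ : β ∈ leadExpos r I) => hr.exists_isReducedAt_polyGerm hI hβ
  refine ⟨minimal_finite.toFinset.image fun β => polyGerm (p β),
    isReducedStandardBasis_image hr hI (fun β => minimal_finite.mem_toFinset) fun β hβ =>
      hp β (minimal_finite.mem_toFinset.1 hβ).prop,
    Finset.forall_mem_image.2 fun β _ => ⟨p β, rfl⟩⟩

theorem existsUnique_isReducedStandardBasis_isPolynomialGerm (hr : IsLocalOrder r)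
    (hI : FiniteCodimension I) :
    ∃! G : Finset SmoothGerm, IsReducedStandardBasis r I G ∧ ∀ g ∈ G, IsPolynomialGerm g := by
  obtain ⟨G, hG, hGp⟩ := exists_isReducedStandardBasis_isPolynomialGerm hr hI
  exact ⟨G, ⟨hG, hGp⟩, fun H hH => hH.1.eq_of_isPolynomialGerm hr hG hH.2 hGp⟩

end ReducedStandardBasis

section Remainder

variable {r : Expo → Expo → Prop} {I : Ideal SmoothGerm} {G : Finset SmoothGerm}
  {f s : SmoothGerm}

theorem isRemainder_of_mem_termwiseSpan (hr : IsLocalOrder r) {D : Ideal SmoothGerm}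
    (hD : ∀ u ∈ D, LeadLE r u f) (hs : f - s ∈ termwiseSpan (G : Set SmoothGerm) D)
    (hdisj : Disjoint (jetSupport s) (leadExpos r (G : Set SmoothGerm))) :
    IsRemainder r f G s := by
  obtain ⟨q, hq, hsum⟩ := exists_eq_sum_of_mem_termwiseSpan hs
  exact ⟨⟨q, fun g hg => hD _ (hq g hg), by rw [← hsum, sub_sub_cancel]⟩,
    (forall_not_leadTerm_dvd_iff hr).2 hdisj⟩

theorem IsRemainder.sub_mem_span (hs : IsRemainder r f G s) :
    f - s ∈ Ideal.span (G : Set SmoothGerm) := by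
  obtain ⟨⟨q, -, rfl⟩, -⟩ := hs
  rw [sub_sub_cancel]
  exact sum_mem fun g hg => Ideal.mul_mem_left _ _ (Ideal.subset_span hg)

theorem IsRemainder.disjoint (hr : IsLocalOrder r) (hs : IsRemainder r f G s) :
    Disjoint (jetSupport s) (leadExpos r (G : Set SmoothGerm)) :=
  (forall_not_leadTerm_dvd_iff hr).1 hs.2

theorem IsStandardBasis.isFlat_sub (hr : IsLocalOrder r) (hG : IsStandardBasis r I G)
    {s' : SmoothGerm} (hs : IsRemainder r f G s) (hs' : IsRemainder r f G s') :
    IsFlat (s - s') := by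
  have hmem : s - s' ∈ (I : Set SmoothGerm) := by
    rw [SetLike.mem_coe, ← hG.span_eq]
    simpa using sub_mem hs'.sub_mem_span hs.sub_mem_span
  refine hr.isFlat_of_disjoint_leadExpos hmem (Disjoint.mono_left (jetSupport_sub_subset s s') ?_)
  rw [← hG.leadExpos_eq hr]
  exact (hs.disjoint hr).union_left (hs'.disjoint hr)

theorem IsStandardBasis.totalDegree_le (hr : IsLocalOrder r) (hG : IsStandardBasis r I G)
    {p : MvPolynomial (Fin 2) ℝ} (hp : IsRemainder r f G (polyGerm p)) {k : ℕ}
    (hk : maxIdeal ^ (k + 1) ≤ I) : p.totalDegree ≤ k := by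
  have hdisj := hp.disjoint hr
  rw [hG.leadExpos_eq hr, jetSupport_polyGerm, Set.disjoint_left] at hdisj
  refine Finset.sup_le fun α hα => not_lt.1 fun hkα => hdisj hα ?_
  exact mem_leadExpos_of_le_degree hk hkα

theorem IsStandardBasis.pow_add_le_termwiseSpan (hG : IsStandardBasis r I G) {n k : ℕ}
    (hk : maxIdeal ^ k ≤ I) :
    maxIdeal ^ (n + k) ≤ termwiseSpan (G : Set SmoothGerm) (maxIdeal ^ n) := by
  rw [pow_add]
  refine (Ideal.mul_mono_right ?_).trans (mul_span_le_termwiseSpan _ _)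
  rwa [hG.span_eq]

/-- Flat germs lie in `𝓜 ^ k * flatIdeal`, so they are combinations of `G` with flat summands. -/
theorem IsStandardBasis.isRemainder_zero_of_isFlat (hr : IsLocalOrder r)
    (hG : IsStandardBasis r I G) (hI : FiniteCodimension I) (hf : IsFlat f) :
    IsRemainder r f G 0 := by
  obtain ⟨k, hk⟩ := hI
  refine isRemainder_of_mem_termwiseSpan hr (D := flatIdeal) (fun u hu α hα => ?_) ?_ ?_
  · exact absurd (congrFun (mem_flatIdeal.1 hu) α) hα.1
  · rw [sub_zero]
    refine mul_span_le_termwiseSpan (G : Set SmoothGerm) flatIdeal ?_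
    rw [hG.span_eq, mul_comm]
    exact Ideal.mul_mono_left hk (flatIdeal_le_maxIdeal_pow_mul k (mem_flatIdeal.2 hf))
  · rw [jetSupport_zero]
    exact Set.empty_disjoint _

theorem IsLocalOrder.exists_maxIdeal_pow_le_supportIdeal (hr : IsLocalOrder r) {β : Expo}
    (hβ : {α | r β α}.Finite) :
    ∃ n, maxIdeal ^ n ≤ supportIdeal (exposLE r β) (hr.isUpperSet_exposLE β) := by
  obtain ⟨n, hn⟩ := (hβ.image Finsupp.degree).bddAbove
  refine ⟨n + 1, fun u hu α hα => hr.mem_exposLE_of_not_lt fun hβα => ?_⟩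
  exact (mem_maxIdeal_pow.1 hu α hα).not_gt (Nat.lt_succ_of_le (hn ⟨α, hβα, rfl⟩))

theorem IsStandardBasis.exists_isRemainder_polyGerm (hr : IsLocalOrder r)
    (hfin : ∀ β, {α | r β α}.Finite) (hG : IsStandardBasis r I G) (hI : FiniteCodimension I)
    (f : SmoothGerm) : ∃ p, IsRemainder r f G (polyGerm p) := by
  by_cases hf : IsFlat f
  · exact ⟨0, polyGerm_zero.symm ▸ hG.isRemainder_zero_of_isFlat hr hI hf⟩
  obtain ⟨β, hβ⟩ := hr.exists_isLeadExpo hf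
  obtain ⟨k, hk⟩ := hI
  obtain ⟨n, hn⟩ := hr.exists_maxIdeal_pow_le_supportIdeal (hfin β)
  obtain ⟨p, hdisj, hp⟩ := hr.exists_sub_polyGerm_mem (G : Set SmoothGerm) (n + k)
    (isLeadExpo_iff.1 hβ).2
  rw [sup_eq_left.2 ((hG.pow_add_le_termwiseSpan hk).trans (termwiseSpan_mono_right _ hn))] at hp
  refine ⟨p, isRemainder_of_mem_termwiseSpan hr (fun u hu α hα => ?_) hp
    (jetSupport_polyGerm p ▸ hdisj)⟩
  exact ⟨β, hβ, mem_supportIdeal.1 hu hα.1⟩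

end Remainder

section AlexOrder

theorem alexLT_iff {α β : Expo} : alexLT α β ↔ β 0 + β 1 < α 0 + α 1 ∨
    (α 0 + α 1 = β 0 + β 1 ∧ (α 0 < β 0 ∨ (α 0 = β 0 ∧ α 1 < β 1))) := by
  simp [alexLT, lexLT, Finsupp.degree_eq_sum, Fin.exists_fin_two]

theorem isLocalOrder_alexLT : IsLocalOrder alexLT where
  strictTotal :=
    { trichotomous := fun α β => by
        rw [alexLT_iff, alexLT_iff, Finsupp.ext_iff, Fin.forall_fin_two]
        omega
      irrefl := fun α => by
        rw [alexLT_iff]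
        omega
      trans := fun α β γ => by
        simp only [alexLT_iff]
        omega }
  add_right α β γ := by
    simp only [alexLT_iff, Finsupp.add_apply]
    omega
  var_lt_one i := Or.inl (by simp [Finsupp.degree_single])

theorem finite_alexLT (β : Expo) : {α | alexLT β α}.Finite :=
  (Finsupp.finite_of_degree_le β.degree).subset fun _ hα => hα.elim le_of_lt fun h => h.1.ge

end AlexOrder

theorem mainTheorem4_general (I : Ideal SmoothGerm) (hI : FiniteCodimension I) :
    (∀ r : Expo → Expo → Prop, IsLocalOrder r →
      (∃! G : Finset SmoothGerm,
        IsReducedStandardBasis r I G ∧ ∀ g ∈ G, IsPolynomialGerm g) ∧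
      (∀ G H : Finset SmoothGerm,
        IsReducedStandardBasis r I G → IsReducedStandardBasis r I H →
          infJet '' (G : Set SmoothGerm) = infJet '' (H : Set SmoothGerm))) ∧
    (∀ r : Expo → Expo → Prop, IsLocalOrder r → (∀ β, {α | r β α}.Finite) →
      ∀ G : Finset SmoothGerm, IsStandardBasis r I G → ∀ f : SmoothGerm,
      ∃ p : MvPolynomial (Fin 2) ℝ,
        IsRemainder r f G (polyGerm p) ∧
        (∀ p' : MvPolynomial (Fin 2) ℝ, IsRemainder r f G (polyGerm p') → p' = p) ∧
        (∀ s : SmoothGerm, IsRemainder r f G s → IsFlat (s - polyGerm p)) ∧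
        (∀ k : ℕ, maxIdeal ^ (k + 1) ≤ I → p.totalDegree ≤ k)) := by
  refine ⟨fun r hr => ⟨existsUnique_isReducedStandardBasis_isPolynomialGerm hr hI,
    fun G H hG hH => hG.image_infJet_eq hr hH⟩, fun r hr hfin G hG f => ?_⟩
  obtain ⟨p, hp⟩ := hG.exists_isRemainder_polyGerm hr hfin hI f
  refine ⟨p, hp, fun p' hp' => ?_, fun s hs => hG.isFlat_sub hr hs hp,
    fun k hk => hG.totalDegree_le hr hp hk⟩
  exact infJet_polyGerm_injective (isFlat_sub_iff.1 (hG.isFlat_sub hr hp' hp))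

theorem mainTheorem4 (I : Ideal SmoothGerm) (hI : FiniteCodimension I) :
    (∀ r : Expo → Expo → Prop, IsLocalOrder r →
      (∃! G : Finset SmoothGerm,
        IsReducedStandardBasis r I G ∧ ∀ g ∈ G, IsPolynomialGerm g) ∧
      (∀ G H : Finset SmoothGerm,
        IsReducedStandardBasis r I G → IsReducedStandardBasis r I H →
          infJet '' (G : Set SmoothGerm) = infJet '' (H : Set SmoothGerm))) ∧
    (∀ G : Finset SmoothGerm, IsStandardBasis alexLT I G → ∀ f : SmoothGerm,
      ∃ p : MvPolynomial (Fin 2) ℝ,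
        IsRemainder alexLT f G (polyGerm p) ∧
        (∀ p' : MvPolynomial (Fin 2) ℝ, IsRemainder alexLT f G (polyGerm p') → p' = p) ∧
        (∀ s : SmoothGerm, IsRemainder alexLT f G s → IsFlat (s - polyGerm p)) ∧
        (∀ k : ℕ, maxIdeal ^ (k + 1) ≤ I → p.totalDegree ≤ k)) :=
  (mainTheorem4_general I hI).imp_right fun remainders =>
    remainders alexLT isLocalOrder_alexLT finite_alexLT
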